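/- **Efficient sparse tomography without QRAM and extra qubits.** Consider algorithms that learn an unknown real-valued quantum state $|x\rangle=\sum_{i=0}^{N-1}x_i|i\rangle\in\mathbb{C}^N$ ($x_i\in\mathbb{R}$, $\sum_i x_i^2=1$) only by measuring single, freshly prepared copies of $|x\rangle$ in orthonormal bases of $\mathbb{C}^N$. The bases, and finite uniform random choices, may depend on the earlier outcomes and random choices; no ancilla qubit, no QRAM, no joint operation on several copies and no (controlled) state-preparation unitary is used. The time of such an algorithm is the worst-case number of its steps, where each preparation and measurement of a copy, and each random choice, is one step. There is an absolute constant $C>0$ such that for all $N\ge 2$, $\varepsilon>0$ and $\eta\in(0,1)$ there is an algorithm of this kind, depending only on $N,\varepsilon,\eta$, such that 1. its time (hence its number of measurements) is at most $C\,\dfrac{\log N+\log(1/\eta)}{\varepsilon^2}$; 2. every vector $\hat x\in\mathbb{R}^N$ that it can output has fewer than $36\log N/\varepsilon^2$ nonzero entries; 3. for every real-valued state $|x\rangle$, with probability at least $1-\eta$ the output $\hat x$ satisfies $\|x-\hat x\|_\infty<\varepsilon$ up to a global sign, i.e. $\|x-\hat x\|_\infty<\varepsilon$ or $\|-x-\hat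 x\|_\infty<\varepsilon$. In particular, the time is $O(\log N/\varepsilon^2)$ for every failure probability $\eta$ that is constant or at least a fixed inverse power of $N$, and it is $O(\log(N/\varepsilon)/\varepsilon^2)=\widetilde O(\log N/\varepsilon^2)$ for $\eta=\varepsilon<1$. -/

import Mathlib

/-- The quantum state `∑ i, x i |i⟩` in `ℂ^N` with real amplitudes `x i`
in the computational basis. -/
noncomputable def realState {N : ℕ} (x : Fin N → ℝ) : EuclideanSpace ℂ (Fin N) :=
  WithLp.toLp 2 (fun i => (x i : ℂ))

/-- An (adaptive, randomized) tomography algorithm for an unknown `N`-dimensional state, which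
accesses the state only by measuring single fresh copies in orthonormal bases of `ℂ^N` itself:
there is no ancilla (the measured space is exactly `ℂ^N`), no joint operation on several copies,
no access to a preparation unitary or its controlled version, and no quantum memory.
Every choice may depend on all earlier measurement outcomes and random choices,
but not on the unknown state. -/
inductive TomographyAlgorithm (N : ℕ) : Type
  /-- Stop and output the classical vector `y`. -/
  | output (y : Fin N → ℝ) : TomographyAlgorithm N
  /-- Draw a uniformly random element of a finite set of `m + 1` elements, and continue. -/
  | random (m : ℕ) (next : Fin (m + 1) → TomographyAlgorithm N) : TomographyAlgorithm N
  /-- Take a fresh copy of the state, measure it in the orthonormal basis `b`, and continue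
  according to the outcome. -/
  | measure (b : OrthonormalBasis (Fin N) ℂ (EuclideanSpace ℂ (Fin N)))
      (next : Fin N → TomographyAlgorithm N) : TomographyAlgorithm N

namespace TomographyAlgorithm

/-- The worst-case number of steps: every preparation and measurement of a copy of the state,
and every random choice, costs one unit. In particular it bounds the number of copies used. -/
def time {N : ℕ} : TomographyAlgorithm N → ℕ
  | output _ => 0
  | random _ next => 1 + Finset.univ.sup (fun j => time (next j))
  | measure _ next => 1 + Finset.univ.sup (fun j => time (next j))

/-- The set of all vectors that the algorithm can output, along any branch whatsoever. -/
def outputs {N : ℕ} : TomographyAlgorithm N → Set (Fin N → ℝ)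
  | output y => {y}
  | random _ next => ⋃ j, outputs (next j)
  | measure _ next => ⋃ j, outputs (next j)

open Classical in
/-- The probability that the output of the algorithm, run on copies of the state `ψ`, lies
in `G`. Measurement outcomes obey the Born rule: outcome `j` has probability `|⟨b_j|ψ⟩|²`. -/
noncomputable def prob {N : ℕ} (ψ : EuclideanSpace ℂ (Fin N)) (G : Set (Fin N → ℝ)) :
    TomographyAlgorithm N → ℝ
  | output y => if y ∈ G then 1 else 0
  | random m next => ∑ j, (1 / ((m : ℝ) + 1)) * prob ψ G (next j)
  | measure b next => ∑ j, ‖inner ℂ (b j) ψ‖ ^ 2 * prob ψ G (next j)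

end TomographyAlgorithm

/-- The vectors within distance less than `ε` of `x` in the `ℓ∞` norm (the norm of `Fin N → ℝ`),
up to the unobservable global sign of `x`. -/
def approximations {N : ℕ} (x : Fin N → ℝ) (ε : ℝ) : Set (Fin N → ℝ) :=
  {y | ‖x - y‖ < ε ∨ ‖-x - y‖ < ε}

/-!
The algorithm first measures `O(log (N / η) / ε²)` copies in the computational basis. By a Chernoff
bound for square roots of frequencies (`hasChernoffBound_upper`, `hasChernoffBound_lower`), this
determines all moduli `|x i|` up to `ε / 4`. Coordinates with estimate below `ε / 2` are output as
zero; there are at most `4 / ε²` others, since the frequencies sum to one, and each of these heavy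
coordinates has `|x i| ≥ ε / 4`. It remains to find their signs.

Number the heavy coordinates by positions `a < n`. The signs are found by merging residue classes
of positions: once the signs within the classes of `r` and `r + T` modulo `2 T` are known up to a
global sign each, let `u` and `v` be the flat unit vectors on these classes with the known signs,
and measure in a basis containing `(u + v) / √2` and `(u - v) / √2`. The more frequent of the two
outcomes tells the sign of `⟨u, x⟩ ⟨v, x⟩`, hence the relative sign of the classes
(`coherent_mergeSigns`). All pairs of classes share one basis. The squared difference of the square
roots of the two outcome probabilities is `2 min (⟨u, x⟩², ⟨v, x⟩²)`, which by
`le_classAmp_sq` is at least of order `ε²` times the class size, so by `hasChernoffBound_compare`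
about `log (N / η) / (ε² n / T)` copies suffice for this merge
(`hasChernoffBound_mergeFails`). Residue classes are used because they stay balanced for every `n`
(`le_classCard`). Merging starts from singletons, `T ≥ n / 2`, and ends with a single class,
`T = 1`. The numbers of copies form a geometric series dominated by its first term, of order
`log (N / η) / ε²`, so that no further logarithmic factor arises. Fewer than `2 N + 2` merges take
place, which the union bound absorbs (`le_prob_signPhase`).
-/

/-! ### Repeated measurements and Chernoff bounds -/

namespace TomographyAlgorithm

/-- The Born probability of outcome `j` when `ψ` is measured in the basis `b`. -/
noncomputable def born {N : ℕ} (b : OrthonormalBasis (Fin N) ℂ (EuclideanSpace ℂ (Fin N)))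
    (ψ : EuclideanSpace ℂ (Fin N)) (j : Fin N) : ℝ :=
  ‖inner ℂ (b j) ψ‖ ^ 2

/-- Measure `m` fresh copies in the basis `b` and continue according to how often each
outcome occurred. -/
def measureMany {N : ℕ} (b : OrthonormalBasis (Fin N) ℂ (EuclideanSpace ℂ (Fin N))) :
    ℕ → ((Fin N → ℕ) → TomographyAlgorithm N) → TomographyAlgorithm N
  | 0, k => k 0
  | m + 1, k => measure b fun j => measureMany b m fun c => k (c + Pi.single j 1)

/-- The expectation of `h c`, where `c` counts the occurrences of each outcome in `m` independent
draws from the distribution `P`. -/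
noncomputable def countExpect {N : ℕ} (P : Fin N → ℝ) : ℕ → ((Fin N → ℕ) → ℝ) → ℝ
  | 0, h => h 0
  | m + 1, h => ∑ j, P j * countExpect P m fun c => h (c + Pi.single j 1)

/-- A Chernoff certificate that the event `E` on the outcome counts of `m` independent draws from
`P` has probability at most `β`: the indicator of `E` is dominated by `κ ∏ j, g j ^ c j`, whose
expectation `κ (∑ j, P j * g j) ^ m` is at most `β`. -/
def HasChernoffBound {N : ℕ} (P : Fin N → ℝ) (m : ℕ) (E : (Fin N → ℕ) → Prop) (β : ℝ) : Prop :=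
  ∃ (κ : ℝ) (g : Fin N → ℝ), 0 ≤ κ ∧ (∀ j, 0 ≤ g j) ∧ (∀ c, E c → 1 ≤ κ * ∏ j, g j ^ c j) ∧
    κ * (∑ j, P j * g j) ^ m ≤ β

variable {N : ℕ} {b : OrthonormalBasis (Fin N) ℂ (EuclideanSpace ℂ (Fin N))}
  {ψ : EuclideanSpace ℂ (Fin N)} {P : Fin N → ℝ}

lemma born_nonneg (j : Fin N) : 0 ≤ born b ψ j := by unfold born; positivity

lemma sum_born (hψ : ‖ψ‖ = 1) : ∑ j, born b ψ j = 1 := by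
  simp only [born, b.sum_sq_norm_inner_right, hψ, one_pow]

lemma norm_realState {x : Fin N → ℝ} (hx : ∑ i, x i ^ 2 = 1) : ‖realState x‖ = 1 := by
  have h : ‖realState x‖ ^ 2 = 1 := by
    rw [EuclideanSpace.norm_sq_eq, ← hx]
    simp [realState]
  nlinarith [norm_nonneg (realState x)]

lemma prob_nonneg (G : Set (Fin N → ℝ)) (A : TomographyAlgorithm N) : 0 ≤ A.prob ψ G := by
  induction A with
  | output y => unfold prob; split_ifs <;> norm_num
  | random m next ih =>
    unfold prob
    exact Finset.sum_nonneg fun j _ => mul_nonneg (by positivity) (ih j)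
  | measure b next ih =>
    unfold prob
    exact Finset.sum_nonneg fun j _ => mul_nonneg (by positivity) (ih j)

lemma prob_measureMany (G : Set (Fin N → ℝ)) (m : ℕ) (k : (Fin N → ℕ) → TomographyAlgorithm N) :
    (measureMany b m k).prob ψ G = countExpect (born b ψ) m fun c => (k c).prob ψ G := by
  induction m generalizing k with
  | zero => rfl
  | succ m ih =>
    simp only [measureMany, countExpect, prob, born, ih]

lemma sum_add_single (c : Fin N → ℕ) (j : Fin N) :
    ∑ i, (c + Pi.single j 1 : Fin N → ℕ) i = (∑ i, c i) + 1 := by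
  simp [Finset.sum_add_distrib]

lemma time_measureMany_le {m t : ℕ} {k : (Fin N → ℕ) → TomographyAlgorithm N}
    (hk : ∀ c, ∑ i, c i = m → (k c).time ≤ t) : (measureMany b m k).time ≤ m + t := by
  induction m generalizing k with
  | zero => simpa [measureMany] using hk 0 (by simp)
  | succ m ih =>
    have h : ∀ j, (measureMany b m fun c => k (c + Pi.single j 1)).time ≤ m + t := fun j =>
      ih fun c hc => hk _ (by rw [sum_add_single, hc])
    have := Finset.sup_le (s := Finset.univ) fun j _ => h j
    simp only [measureMany, time]
    omega

lemma exists_of_mem_outputs_measureMany {m : ℕ} {k : (Fin N → ℕ) → TomographyAlgorithm N}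
    {y : Fin N → ℝ} (hy : y ∈ (measureMany b m k).outputs) :
    ∃ c, ∑ i, c i = m ∧ y ∈ (k c).outputs := by
  induction m generalizing k with
  | zero => exact ⟨0, by simp, hy⟩
  | succ m ih =>
    unfold measureMany outputs at hy
    obtain ⟨j, hj⟩ := Set.mem_iUnion.1 hy
    obtain ⟨c, hc, h⟩ := ih hj
    exact ⟨_, by rw [sum_add_single, hc], h⟩

lemma prod_pow_add_single (g : Fin N → ℝ) (c : Fin N → ℕ) (j : Fin N) :
    ∏ i, g i ^ (c + Pi.single j 1 : Fin N → ℕ) i = g j * ∏ i, g i ^ c i := by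
  simp only [Pi.add_apply, pow_add, Finset.prod_mul_distrib]
  rw [mul_comm, Finset.prod_eq_single (a := j)]
  · simp
  · intro i _ hi
    simp [hi]
  · simp

/-- The form of the union bound that passes through the recursion over single measurements. -/
lemma sub_sum_le_countExpect (hP : ∀ j, 0 ≤ P j) (hP1 : ∑ j, P j = 1) {ι : Type*} (I : Finset ι)
    (m : ℕ) (κ : ι → ℝ) (g : ι → Fin N → ℝ) (a : ℝ) (h : (Fin N → ℕ) → ℝ)
    (hle : ∀ c, a - ∑ i ∈ I, κ i * ∏ j, g i j ^ c j ≤ h c) :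
    a - ∑ i ∈ I, κ i * (∑ j, P j * g i j) ^ m ≤ countExpect P m h := by
  induction m generalizing κ h with
  | zero => simpa [countExpect] using hle 0
  | succ m ih =>
    have key : ∀ j, a - ∑ i ∈ I, κ i * g i j * (∑ j, P j * g i j) ^ m ≤
        countExpect P m fun c => h (c + Pi.single j 1) := fun j =>
      ih (fun i => κ i * g i j) _ fun c => by
        have h2 := hle (c + Pi.single j 1)
        simp_rw [prod_pow_add_single, ← mul_assoc] at h2
        exact h2
    calc a - ∑ i ∈ I, κ i * (∑ j, P j * g i j) ^ (m + 1)
        = ∑ j, P j * (a - ∑ i ∈ I, κ i * g i j * (∑ j, P j * g i j) ^ m) := by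
          simp only [mul_sub, Finset.sum_sub_distrib, ← Finset.sum_mul, hP1, one_mul,
            Finset.mul_sum]
          rw [Finset.sum_comm]
          congr 1
          refine Finset.sum_congr rfl fun i _ => ?_
          rw [pow_succ, mul_comm (_ ^ m), Finset.sum_mul, Finset.mul_sum]
          exact Finset.sum_congr rfl fun j _ => by ring
      _ ≤ _ := Finset.sum_le_sum fun j _ => mul_le_mul_of_nonneg_left (key j) (hP j)

/-- Union bound: if the algorithm succeeds with probability at least `a` whenever the measured
counts avoid all the events `E i`, then it succeeds with probability at least `a - ∑ i, β i`. -/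
lemma sub_sum_le_prob_measureMany (hψ : ‖ψ‖ = 1) {ι : Type*} (I : Finset ι) {m : ℕ}
    {E : ι → (Fin N → ℕ) → Prop} {β : ι → ℝ} {a : ℝ} (ha : a ≤ 1) {G : Set (Fin N → ℝ)}
    {k : (Fin N → ℕ) → TomographyAlgorithm N}
    (hE : ∀ i ∈ I, HasChernoffBound (born b ψ) m (E i) (β i))
    (hk : ∀ c, (∀ i ∈ I, ¬ E i c) → a ≤ (k c).prob ψ G) :
    a - ∑ i ∈ I, β i ≤ (measureMany b m k).prob ψ G := by
  classical
  choose! κ g hκ hg h1 hβ using hE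
  rw [prob_measureMany]
  refine le_trans (sub_le_sub_left (Finset.sum_le_sum hβ) a) ?_
  refine sub_sum_le_countExpect born_nonneg (sum_born hψ) I m κ g a _ fun c => ?_
  have hterm : ∀ i ∈ I, 0 ≤ κ i * ∏ j, g i j ^ c j := fun i hi =>
    mul_nonneg (hκ i hi) (Finset.prod_nonneg fun j _ => pow_nonneg (hg i hi j) _)
  by_cases hc : ∀ i ∈ I, ¬ E i c
  · linarith [hk c hc, Finset.sum_nonneg hterm]
  · push Not at hc
    obtain ⟨i, hi, hEi⟩ := hc
    have := Finset.single_le_sum hterm hi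
    linarith [h1 i hi c hEi, prob_nonneg (ψ := ψ) G (k c)]

/-- The Chernoff exponent, with the tilt `t = s / r` that turns it into a squared distance of
square roots. -/
lemma chernoff_exponent_le {r s : ℝ} (hr : 0 < r) (hs : 0 < s) :
    r ^ 2 * (s / r - 1) - s ^ 2 * Real.log (s / r) ≤ -(s - r) ^ 2 := by
  have h := Real.one_sub_inv_le_log_of_pos (div_pos hs hr)
  have h2 := mul_le_mul_of_nonneg_left h (sq_nonneg s)
  have e1 : r ^ 2 * (s / r - 1) = r * s - r ^ 2 := by field_simp
  have e2 : s ^ 2 * (1 - (s / r)⁻¹) = s ^ 2 - r * s := by field_simp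
  nlinarith

/-- Chernoff bound for the number of occurrences of one outcome, tilted by `s / r`. It covers
both tails: `s > r` for `c i` too large and `s < r` for `c i` too small. The hypotheses `hE` and
`hPr` are multiplied by the logarithm and by `s / r - 1` because these change sign with the tail. -/
lemma hasChernoffBound_single (hP : ∀ j, 0 ≤ P j) (hP1 : ∑ j, P j = 1) (i : Fin N) (m : ℕ)
    {r s : ℝ} (hr : 0 < r) (hs : 0 < s) {E : (Fin N → ℕ) → Prop}
    (hE : ∀ c, E c → m * s ^ 2 * Real.log (s / r) ≤ c i * Real.log (s / r))
    (hPr : P i * (s / r - 1) ≤ r ^ 2 * (s / r - 1)) :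
    HasChernoffBound P m E (Real.exp (-(m * (s - r) ^ 2))) := by
  have ht : 0 < s / r := div_pos hs hr
  have hg : ∀ j, 0 ≤ (if j = i then s / r else 1) := fun j => by split_ifs <;> positivity
  refine ⟨Real.exp (-(m * s ^ 2 * Real.log (s / r))), fun j => if j = i then s / r else 1,
    (Real.exp_pos _).le, hg, fun c hc => ?_, ?_⟩
  · rw [Finset.prod_eq_single (a := i) (by intro j _ hj; simp [hj]) (by simp)]
    simp only [if_pos]
    rw [← Real.exp_log (pow_pos ht _), ← Real.exp_add, Real.log_pow]
    exact Real.one_le_exp (by linarith [hE c hc])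
  · have hsum : ∑ j, P j * (if j = i then s / r else 1) = 1 + P i * (s / r - 1) := by
      have : ∀ j, P j * (if j = i then s / r else 1) =
          P j + (if j = i then P j * (s / r - 1) else 0) := fun j => by split_ifs <;> ring
      simp [this, Finset.sum_add_distrib, hP1]
    have h0 : 0 ≤ ∑ j, P j * (if j = i then s / r else 1) :=
      Finset.sum_nonneg fun j _ => mul_nonneg (hP j) (hg j)
    have h1 : ∑ j, P j * (if j = i then s / r else 1) ≤ Real.exp (r ^ 2 * (s / r - 1)) := by
      rw [hsum]
      linarith [Real.add_one_le_exp (r ^ 2 * (s / r - 1))]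
    calc _ ≤ Real.exp (-(m * s ^ 2 * Real.log (s / r))) *
          Real.exp (r ^ 2 * (s / r - 1)) ^ m := by gcongr
      _ = Real.exp (m * (r ^ 2 * (s / r - 1) - s ^ 2 * Real.log (s / r))) := by
          rw [← Real.exp_nat_mul, ← Real.exp_add]; ring_nf
      _ ≤ _ := by
          rw [← mul_neg]
          exact Real.exp_le_exp.2 (mul_le_mul_of_nonneg_left (chernoff_exponent_le hr hs)
            (Nat.cast_nonneg m))

/-- The square root of an empirical frequency estimates the amplitude `a` of an outcome from
above. The tilt is aimed at `a + δ / 2` instead of `a`, so that `a = 0` needs no separate case. -/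
lemma hasChernoffBound_upper (hP : ∀ j, 0 ≤ P j) (hP1 : ∑ j, P j = 1) (i : Fin N) {m : ℕ}
    (hm : 0 < m) {a δ : ℝ} (ha : 0 ≤ a) (hPa : P i = a ^ 2) (hδ : 0 < δ) :
    HasChernoffBound P m (fun c => a + δ ≤ √(c i / m)) (Real.exp (-(m * (δ / 2) ^ 2))) := by
  have hm' : (0 : ℝ) < m := by exact_mod_cast hm
  have ht : 1 ≤ (a + δ) / (a + δ / 2) := by rw [one_le_div (by positivity)]; linarith
  have := hasChernoffBound_single hP hP1 i m (r := a + δ / 2) (s := a + δ)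
    (E := fun c => a + δ ≤ √(c i / m)) (by positivity) (by positivity) ?_ ?_
  · convert this using 5; ring
  · intro c hc
    refine mul_le_mul_of_nonneg_right ?_ (Real.log_nonneg ht)
    rw [Real.le_sqrt (by positivity) (by positivity), le_div_iff₀ hm'] at hc
    linarith
  · refine mul_le_mul_of_nonneg_right ?_ (by linarith)
    rw [hPa]
    gcongr
    linarith

lemma hasChernoffBound_lower (hP : ∀ j, 0 ≤ P j) (hP1 : ∑ j, P j = 1) (i : Fin N) {m : ℕ}
    (hm : 0 < m) {a δ : ℝ} (hPa : P i = a ^ 2) (hδ : 0 < δ) :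
    HasChernoffBound P m (fun c => √(c i / m) ≤ a - δ) (Real.exp (-(m * (δ / 2) ^ 2))) := by
  have hm' : (0 : ℝ) < m := by exact_mod_cast hm
  by_cases had : a < δ
  · -- The event is empty, because square roots are nonnegative.
    refine ⟨0, 1, le_rfl, fun _ => zero_le_one, fun c hc => ?_, by simpa using (Real.exp_pos _).le⟩
    linarith [Real.sqrt_nonneg ((c i : ℝ) / m)]
  push Not at had
  have hs : 0 < a - δ / 2 := by linarith
  have ht : (a - δ / 2) / a ≤ 1 := by rw [div_le_one (by linarith)]; linarith
  have := hasChernoffBound_single hP hP1 i m (r := a) (s := a - δ / 2)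
    (E := fun c => √(c i / m) ≤ a - δ) (by linarith) hs ?_ (by rw [hPa])
  · convert this using 3; ring
  · intro c hc
    refine mul_le_mul_of_nonpos_right ?_
      (Real.log_nonpos (div_nonneg hs.le (by linarith)) ht)
    rw [Real.sqrt_le_left (by linarith), div_le_iff₀ hm'] at hc
    refine hc.trans ?_
    rw [mul_comm]
    gcongr
    linarith

/-- If outcomes `i` and `j` have probabilities `u ^ 2 > v ^ 2`, then `j` is unlikely to occur at
least as often as `i`. -/
lemma hasChernoffBound_compare (hP : ∀ j, 0 ≤ P j) (hP1 : ∑ j, P j = 1) {i j : Fin N}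
    (hij : i ≠ j) (m : ℕ) {u v : ℝ} (hv : 0 ≤ v) (huv : v < u) (hPi : P i = u ^ 2)
    (hPj : P j = v ^ 2) :
    HasChernoffBound P m (fun c => c i ≤ c j) (Real.exp (-(m * ((u - v) ^ 2 / 2)))) := by
  -- The optimal tilt `u / v` degenerates at `v = 0`; this one costs only a factor of two.
  obtain ⟨t, ht⟩ : ∃ t, t = 2 * u / (u + v) := ⟨_, rfl⟩
  have hu : 0 < u := hv.trans_lt huv
  have ht1 : 1 ≤ t := by rw [ht, one_le_div (by positivity)]; linarith
  have ht0 : 0 < t := by linarith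
  let g : Fin N → ℝ := fun l => if l = i then t⁻¹ else if l = j then t else 1
  have hgi : g i = t⁻¹ := by simp [g]
  have hgj : g j = t := by simp [g, hij.symm]
  have hgl : ∀ l, l ≠ i ∧ l ≠ j → g l = 1 := fun l hl => by simp [g, hl.1, hl.2]
  have hg : ∀ l, 0 ≤ g l := fun l => by simp only [g]; split_ifs <;> positivity
  refine ⟨1, g, zero_le_one, hg, fun c hc => ?_, ?_⟩
  · rw [one_mul, Finset.prod_eq_mul i j hij (fun l _ hl => by rw [hgl l hl, one_pow])
      (by simp) (by simp), hgi, hgj, inv_pow, inv_mul_eq_div, one_le_div (by positivity)]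
    exact pow_le_pow_right₀ ht1 hc
  · have hsum : ∑ l, P l * g l = 1 + (P i * (t⁻¹ - 1) + P j * (t - 1)) := by
      have h1 : ∑ l, P l * (g l - 1) = P i * (t⁻¹ - 1) + P j * (t - 1) := by
        rw [Finset.sum_eq_add i j hij (fun l _ hl => by rw [hgl l hl, sub_self, mul_zero])
          (by simp) (by simp), hgi, hgj]
      rw [← h1]
      simp only [mul_sub, mul_one, Finset.sum_sub_distrib, hP1]
      ring
    have hle : P i * (t⁻¹ - 1) + P j * (t - 1) ≤ -((u - v) ^ 2 / 2) := by
      have e : u ^ 2 * (t⁻¹ - 1) + v ^ 2 * (t - 1) =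
          -((u - v) ^ 2 / 2) - (u - v) ^ 2 * v / (2 * (u + v)) := by
        rw [ht]
        field_simp
        ring
      have : 0 ≤ (u - v) ^ 2 * v / (2 * (u + v)) := by positivity
      rw [hPi, hPj, e]
      linarith
    have h0 : 0 ≤ ∑ l, P l * g l := Finset.sum_nonneg fun l _ => mul_nonneg (hP l) (hg l)
    have h1 : ∑ l, P l * g l ≤ Real.exp (-((u - v) ^ 2 / 2)) := by
      rw [hsum]
      linarith [Real.add_one_le_exp (-((u - v) ^ 2 / 2))]
    calc _ ≤ 1 * Real.exp (-((u - v) ^ 2 / 2)) ^ m := by gcongr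
      _ = _ := by rw [one_mul, ← Real.exp_nat_mul, mul_neg]

end TomographyAlgorithm

/-! ### Merging residue classes of positions -/

namespace TomographyAlgorithm

variable {N n : ℕ}

/-- The number of positions `a < n` in the residue class of `s` modulo `Q`. -/
def classCard (n Q s : ℕ) : ℕ := (Finset.univ.filter fun a : Fin n => a.1 % Q = s).card

/-- The inner product of the real state `x` with `1 / √2` times the flat unit vector that has
signs `σ` and is supported on the positions `≡ s` modulo `Q`. -/
noncomputable def classAmp (f : Fin n → Fin N) (σ : Fin n → ℝ) (x : Fin N → ℝ) (Q s : ℕ) : ℝ :=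
  ∑ a : Fin n, if a.1 % Q = s then σ a * x (f a) / √(2 * classCard n Q s) else 0

/-- The remainder of a position modulo `T`, again as a position. -/
def posMod (T : ℕ) (a : Fin n) : Fin n := ⟨a.1 % T, (Nat.mod_le a.1 T).trans_lt a.2⟩

/-- The coefficients of the measured vector with index `p`, where `p < 2 * T`: the normalized sum
(for `p < T`) or difference (for `T ≤ p`) of the flat vectors on the residue classes of `p % T`
and `p % T + T` modulo `2 * T`. -/
noncomputable def mergeRow (σ : Fin n → ℝ) (T : ℕ) (p a : Fin n) : ℝ :=
  if a.1 % T = p.1 % T then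
    σ a / √(2 * classCard n (T * 2) (a.1 % (T * 2))) *
      (if T ≤ p.1 ∧ T ≤ a.1 % (T * 2) then -1 else 1)
  else 0

lemma mod_eq_iff_mod_mul_two {T r : ℕ} (hr : r < T) (a : ℕ) :
    a % T = r ↔ a % (T * 2) = r ∨ a % (T * 2) = r + T := by
  have h := Nat.mod_mul (a := T) (b := 2) (x := a)
  have h3 := Nat.mod_lt a (hr.trans_le' (Nat.zero_le r))
  rcases Nat.mod_two_eq_zero_or_one (a / T) with h2 | h2 <;> rw [h2] at h <;> omega

lemma sum_ite_mod_eq {T r : ℕ} (hr : r < T) (F : Fin n → ℝ) :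
    (∑ a : Fin n, if a.1 % T = r then F a else 0) =
      (∑ a : Fin n, if a.1 % (T * 2) = r then F a else 0) +
        ∑ a : Fin n, if a.1 % (T * 2) = r + T then F a else 0 := by
  rw [← Finset.sum_add_distrib]
  refine Finset.sum_congr rfl fun a _ => ?_
  have h := mod_eq_iff_mod_mul_two hr a.1
  by_cases h1 : a.1 % (T * 2) = r
  · rw [if_pos (h.2 (Or.inl h1)), if_pos h1, if_neg (by omega), add_zero]
  · by_cases h2 : a.1 % (T * 2) = r + T
    · rw [if_pos (h.2 (Or.inr h2)), if_neg h1, if_pos h2, zero_add]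
    · rw [if_neg (by tauto), if_neg h1, if_neg h2, add_zero]

/-- Residue classes of positions are balanced: up to a factor of two, a nonempty class contains
its full share of the positions. -/
lemma le_classCard {Q s : ℕ} (hs : s < Q) (hsn : s < n) : n + 1 ≤ 2 * Q * classCard n Q s := by
  have h1 : classCard n Q s = n / Q + if s % Q < n % Q then 1 else 0 := by
    rw [← Nat.count_modEq_card n (by omega) s, Nat.count_eq_card_filter_range, classCard]
    refine Finset.card_bij (fun a _ => a.1) ?_ ?_ ?_
    · intro a ha
      simp only [Finset.mem_filter, Finset.mem_univ, true_and] at ha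
      simp [Nat.ModEq, ha, Nat.mod_eq_of_lt hs]
    · intro a _ b _ h
      exact Fin.ext h
    · intro a ha
      simp only [Finset.mem_filter, Finset.mem_range, Nat.ModEq, Nat.mod_eq_of_lt hs] at ha
      exact ⟨⟨a, ha.1⟩, by simpa using ha.2, rfl⟩
  have h2 := Nat.div_add_mod n Q
  have h3 := Nat.mod_lt n (show Q > 0 by omega)
  rw [Nat.mod_eq_of_lt hs] at h1
  rcases Nat.eq_zero_or_pos (n / Q) with h0 | h0
  · have h4 : classCard n Q s = 1 := by
      rw [h1, h0, if_pos]
      rw [h0] at h2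
      omega
    rw [h0] at h2
    rw [h4]
    omega
  · have h5 : n / Q ≤ classCard n Q s := by omega
    have h6 : Q * (n / Q) + Q ≤ 2 * Q * (n / Q) := by nlinarith
    have h7 := Nat.mul_le_mul_left (2 * Q) h5
    omega

lemma sum_class_weights {Q s : ℕ} (hs : s < Q) (hsn : s < n) :
    (∑ a : Fin n, if a.1 % Q = s then 1 / (2 * (classCard n Q s : ℝ)) else 0) = 1 / 2 := by
  have h : (classCard n Q s : ℝ) ≠ 0 := by
    have := le_classCard hs hsn
    intro h
    have h' : classCard n Q s = 0 := by exact_mod_cast h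
    rw [h'] at this
    omega
  rw [← Finset.sum_filter, Finset.sum_const, nsmul_eq_mul]
  change (classCard n Q s : ℝ) * _ = _
  field_simp

lemma sum_mergeRow_mul {T : ℕ} {p : Fin n} (hp : p.1 < T * 2) (σ : Fin n → ℝ)
    (f : Fin n → Fin N) (x : Fin N → ℝ) :
    ∑ a, mergeRow σ T p a * x (f a) = classAmp f σ x (T * 2) (p.1 % T) +
      (if T ≤ p.1 then -1 else 1) * classAmp f σ x (T * 2) (p.1 % T + T) := by
  have hr : p.1 % T < T := Nat.mod_lt _ (by omega)
  conv_lhs => simp only [mergeRow, ite_mul, zero_mul]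
  rw [sum_ite_mod_eq hr, classAmp, classAmp, Finset.mul_sum]
  refine congrArg₂ _ (Finset.sum_congr rfl fun a _ => ?_) (Finset.sum_congr rfl fun a _ => ?_)
  · split_ifs with h1 h2
    · omega
    · rw [h1]; ring
    · rfl
  · by_cases h1 : a.1 % (T * 2) = p.1 % T + T
    · rw [if_pos h1, if_pos h1, h1]
      split_ifs <;> first | omega | ring
    · rw [if_neg h1, if_neg h1, mul_zero]

lemma sum_mergeRow_mul_mergeRow {T : ℕ} {σ : Fin n → ℝ} (hσ : ∀ a, σ a ^ 2 = 1) {p q : Fin n}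
    (hp : p.1 < T * 2) (hpn : p.1 % T + T < n) (hq : q.1 < T * 2) :
    ∑ a, mergeRow σ T p a * mergeRow σ T q a = if p = q then 1 else 0 := by
  have hr : p.1 % T < T := Nat.mod_lt _ (by omega)
  by_cases hpq : q.1 % T = p.1 % T
  · have hterm : ∀ a, mergeRow σ T p a * mergeRow σ T q a =
        if a.1 % T = p.1 % T then 1 / (2 * (classCard n (T * 2) (a.1 % (T * 2)) : ℝ)) *
          ((if T ≤ p.1 ∧ T ≤ a.1 % (T * 2) then -1 else 1) *
            (if T ≤ q.1 ∧ T ≤ a.1 % (T * 2) then -1 else 1)) else 0 := by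
      intro a
      simp only [mergeRow, hpq]
      by_cases h : a.1 % T = p.1 % T
      · simp only [if_pos h]
        rw [mul_mul_mul_comm, div_mul_div_comm, Real.mul_self_sqrt (by positivity), ← pow_two, hσ]
      · simp only [if_neg h, mul_zero]
    have e1 : (∑ a : Fin n, if a.1 % (T * 2) = p.1 % T then
        1 / (2 * (classCard n (T * 2) (a.1 % (T * 2)) : ℝ)) *
          ((if T ≤ p.1 ∧ T ≤ a.1 % (T * 2) then -1 else 1) *
            (if T ≤ q.1 ∧ T ≤ a.1 % (T * 2) then -1 else 1)) else 0) = 1 / 2 := by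
      rw [← sum_class_weights (show p.1 % T < T * 2 by omega) (show p.1 % T < n by omega)]
      refine Finset.sum_congr rfl fun a _ => ?_
      by_cases h : a.1 % (T * 2) = p.1 % T
      · rw [if_pos h, if_pos h, h, if_neg (by omega), if_neg (by omega), mul_one, mul_one]
      · rw [if_neg h, if_neg h]
    have e2 : (∑ a : Fin n, if a.1 % (T * 2) = p.1 % T + T then
        1 / (2 * (classCard n (T * 2) (a.1 % (T * 2)) : ℝ)) *
          ((if T ≤ p.1 ∧ T ≤ a.1 % (T * 2) then -1 else 1) *
            (if T ≤ q.1 ∧ T ≤ a.1 % (T * 2) then -1 else 1)) else 0) =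
        1 / 2 * ((if T ≤ p.1 then -1 else 1) * (if T ≤ q.1 then -1 else 1)) := by
      rw [← sum_class_weights (show p.1 % T + T < T * 2 by omega) hpn, Finset.sum_mul]
      refine Finset.sum_congr rfl fun a _ => ?_
      by_cases h : a.1 % (T * 2) = p.1 % T + T
      · rw [if_pos h, if_pos h, h]
        simp
      · rw [if_neg h, if_neg h, zero_mul]
    simp only [hterm]
    rw [sum_ite_mod_eq hr, e1, e2]
    have hp' := mod_eq_iff_mod_mul_two hr p.1
    have hq' := mod_eq_iff_mod_mul_two hr q.1
    rw [Nat.mod_eq_of_lt hp] at hp'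
    rw [Nat.mod_eq_of_lt hq] at hq'
    have hp2 := hp'.1 rfl
    have hq2 := hq'.1 hpq
    simp only [Fin.ext_iff]
    split_ifs <;> first | omega | norm_num
  · rw [if_neg (by rintro rfl; exact hpq rfl)]
    refine Finset.sum_eq_zero fun a _ => ?_
    simp only [mergeRow]
    by_cases h : a.1 % T = p.1 % T
    · rw [if_neg (show ¬ a.1 % T = q.1 % T by omega), mul_zero]
    · rw [if_neg h, zero_mul]

/-- Real vectors with coefficients `g p` on the coordinates enumerated by `f`, orthonormal for `p`
in `s`, are members of a common orthonormal basis of `ℂ^N`. -/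
lemma exists_orthonormalBasis_of_rows (f : Fin n ↪ Fin N) (g : Fin n → Fin n → ℝ)
    (s : Set (Fin n))
    (hg : ∀ p ∈ s, ∀ q ∈ s, ∑ a, g p a * g q a = if p = q then 1 else 0) :
    ∃ b : OrthonormalBasis (Fin N) ℂ (EuclideanSpace ℂ (Fin N)),
      ∀ p ∈ s, ∀ x, born b (realState x) (f p) = (∑ a, g p a * x (f a)) ^ 2 := by
  let V : Fin n → Fin N → ℝ := fun p => Function.extend f (g p) 0
  have hV : ∀ p (h : Fin N → ℝ), ∑ l, V p l * h l = ∑ a, g p a * h (f a) := by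
    intro p h
    symm
    have : ∀ a, g p a * h (f a) = V p (f a) * h (f a) := fun a => by
      simp only [V, f.injective.extend_apply]
    simp only [this]
    rw [← Finset.sum_map Finset.univ f (fun l => V p l * h l)]
    refine Finset.sum_subset (Finset.subset_univ _) fun l _ hl => ?_
    have : V p l = 0 := Function.extend_apply' _ _ _ (by simpa using hl)
    rw [this, zero_mul]
  have hinner : ∀ p x, inner ℂ (realState (V p)) (realState x) =
      ((∑ a, g p a * x (f a) : ℝ) : ℂ) := by
    intro p x
    rw [← hV, PiLp.inner_apply]
    simp [realState, mul_comm]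
  let v : Fin N → EuclideanSpace ℂ (Fin N) := Function.extend f (fun p => realState (V p)) 0
  have hv : ∀ p, v (f p) = realState (V p) := fun p => f.injective.extend_apply _ _ p
  have hon : Orthonormal ℂ ((f '' s).domRestrict v) := by
    classical
    rw [orthonormal_iff_ite]
    rintro ⟨_, p, hp, rfl⟩ ⟨_, q, hq, rfl⟩
    have h2 : ∀ a, V q (f a) = g q a := fun a => f.injective.extend_apply _ _ a
    simp only [Set.domRestrict_apply, hv, hinner, h2, hg p hp q hq, Subtype.ext_iff]
    by_cases hpq : p = q
    · simp [hpq]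
    · simp [hpq, f.injective.eq_iff]
  obtain ⟨b, hb⟩ := hon.exists_orthonormalBasis_extension_of_card_eq (by simp)
  refine ⟨b, fun p hp x => ?_⟩
  rw [born, hb _ ⟨p, hp, rfl⟩, hv, hinner, Complex.norm_real, Real.norm_eq_abs, sq_abs]

/-- For signs `σ`, some orthonormal basis contains all the vectors `mergeRow σ T p`, in which the
outcomes compare the two halves of every residue class modulo `T`. -/
lemma exists_mergeBasis (f : Fin n ↪ Fin N) (T : ℕ) (σ : Fin n → ℝ) :
    ∃ b : OrthonormalBasis (Fin N) ℂ (EuclideanSpace ℂ (Fin N)), (∀ a, σ a ^ 2 = 1) →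
      ∀ p : Fin n, p.1 < T * 2 → p.1 % T + T < n → ∀ x, born b (realState x) (f p) =
        (classAmp f σ x (T * 2) (p.1 % T) +
          (if T ≤ p.1 then -1 else 1) * classAmp f σ x (T * 2) (p.1 % T + T)) ^ 2 := by
  by_cases hσ : ∀ a, σ a ^ 2 = 1
  · obtain ⟨b, hb⟩ := exists_orthonormalBasis_of_rows f (mergeRow σ T)
      {p | p.1 < T * 2 ∧ p.1 % T + T < n}
      fun p hp q hq => sum_mergeRow_mul_mergeRow hσ hp.1 hp.2 hq.1
    exact ⟨b, fun _ p h1 h2 x => by rw [hb p ⟨h1, h2⟩, sum_mergeRow_mul h1]⟩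
  · exact ⟨EuclideanSpace.basisFun _ _, fun h => absurd h hσ⟩

/-- The basis of `exists_mergeBasis`. -/
noncomputable def mergeBasis (f : Fin n ↪ Fin N) (T : ℕ) (σ : Fin n → ℝ) :
    OrthonormalBasis (Fin N) ℂ (EuclideanSpace ℂ (Fin N)) :=
  (exists_mergeBasis f T σ).choose

/-- Flip the upper half of each residue class modulo `T` whose "difference" outcome occurred more
often than its "sum" outcome. -/
noncomputable def mergeSigns (f : Fin n ↪ Fin N) (T : ℕ) (σ : Fin n → ℝ) (c : Fin N → ℕ)
    (a : Fin n) : ℝ :=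
  if T ≤ a.1 % (T * 2) ∧ c (f (posMod T a)) < c (f (posMod (T * 2) a)) then -σ a else σ a

/-- The signs `σ` agree with those of `x`, up to one global sign for each residue class modulo `Q`
of the positions. -/
def Coherent (f : Fin n ↪ Fin N) (x : Fin N → ℝ) (Q : ℕ) (σ : Fin n → ℝ) : Prop :=
  ∀ a b : Fin n, a.1 % Q = b.1 % Q → 0 < σ a * x (f a) * (σ b * x (f b))

/-- The event that the counts mislead about the relative sign of the two classes whose
"difference" outcome is indexed by `p`. -/
def MergeFails (f : Fin n ↪ Fin N) (x : Fin N → ℝ) (T : ℕ) (σ : Fin n → ℝ) (p : Fin n)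
    (c : Fin N → ℕ) : Prop :=
  if 0 < classAmp f σ x (T * 2) (p.1 % T) * classAmp f σ x (T * 2) (p.1 % T + T) then
    c (f (posMod T p)) ≤ c (f p)
  else c (f p) ≤ c (f (posMod T p))

lemma mergeSigns_sq {f : Fin n ↪ Fin N} {T : ℕ} {σ : Fin n → ℝ} {c : Fin N → ℕ}
    (hσ : ∀ a, σ a ^ 2 = 1) (a : Fin n) : mergeSigns f T σ c a ^ 2 = 1 := by
  unfold mergeSigns
  split_ifs
  · rw [neg_sq, hσ]
  · exact hσ a

lemma classAmp_mul_pos {f : Fin n ↪ Fin N} {x : Fin N → ℝ} {Q : ℕ} {σ : Fin n → ℝ}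
    (h : Coherent f x Q σ) (a : Fin n) : 0 < classAmp f σ x Q (a.1 % Q) * (σ a * x (f a)) := by
  have hcard : 0 < classCard n Q (a.1 % Q) :=
    Finset.card_pos.2 ⟨a, by simp⟩
  rw [classAmp, Finset.sum_mul]
  have hterm : ∀ b : Fin n, b.1 % Q = a.1 % Q →
      0 < σ b * x (f b) / √(2 * classCard n Q (a.1 % Q)) * (σ a * x (f a)) := fun b hb => by
    rw [div_mul_eq_mul_div]
    exact div_pos (h b a hb) (by positivity)
  refine Finset.sum_pos' (fun b _ => ?_) ⟨a, Finset.mem_univ _, ?_⟩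
  · split_ifs with hb
    · exact (hterm b hb).le
    · simp
  · rw [if_pos rfl]
    exact hterm a rfl

/-- Coherent signs make the amplitudes of a class add up, so its mass grows with its size. -/
lemma le_classAmp_sq {f : Fin n ↪ Fin N} {x : Fin N → ℝ} {Q s : ℕ} {σ : Fin n → ℝ} {τ : ℝ}
    (hσ : ∀ a, σ a ^ 2 = 1) (h : Coherent f x Q σ) (hτ : 0 ≤ τ) (hx : ∀ a, τ ≤ |x (f a)|)
    (hs : s < Q) (hsn : s < n) : classCard n Q s * τ ^ 2 / 2 ≤ classAmp f σ x Q s ^ 2 := by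
  let a₀ : Fin n := ⟨s, hsn⟩
  have ha₀ : a₀.1 % Q = s := Nat.mod_eq_of_lt hs
  have hcard : 0 < classCard n Q s := Finset.card_pos.2 ⟨a₀, by simpa using ha₀⟩
  have hcard' : (0 : ℝ) < classCard n Q s := by exact_mod_cast hcard
  have habs : ∀ a, |σ a| = 1 := fun a => by
    rw [← sq_eq_sq₀ (abs_nonneg _) zero_le_one, sq_abs, hσ, one_pow]
  -- Multiplying by the sign of one member of the class turns every summand into its modulus.
  have hε : ∃ e : ℝ, e ^ 2 = 1 ∧ ∀ a : Fin n, a.1 % Q = s → e * (σ a * x (f a)) = |x (f a)| := by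
    have hkey : ∀ a : Fin n, a.1 % Q = s → 0 < σ a₀ * x (f a₀) * (σ a * x (f a)) :=
      fun a ha => h a₀ a (by rw [ha₀, ha])
    have hxa : ∀ a, |x (f a)| = |σ a * x (f a)| := fun a => by rw [abs_mul, habs, one_mul]
    rcases lt_or_gt_of_ne (show σ a₀ * x (f a₀) ≠ 0 from fun h0 => by
      simpa [h0] using hkey a₀ ha₀) with h0 | h0
    · refine ⟨-1, by norm_num, fun a ha => ?_⟩
      rw [hxa, abs_of_neg (neg_of_mul_pos_right (hkey a ha) h0.le)]
      ring
    · refine ⟨1, by norm_num, fun a ha => ?_⟩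
      rw [hxa, abs_of_pos (pos_of_mul_pos_right (hkey a ha) h0.le)]
      ring
  obtain ⟨e, he, hea⟩ := hε
  have h1 : classCard n Q s * (τ / √(2 * classCard n Q s)) ≤ e * classAmp f σ x Q s := by
    rw [classAmp, Finset.mul_sum, ← nsmul_eq_mul, classCard, ← Finset.sum_const,
      Finset.sum_filter]
    refine Finset.sum_le_sum fun a _ => ?_
    split_ifs with ha
    · rw [← mul_div_assoc, hea a ha]
      exact div_le_div_of_nonneg_right (hx a) (Real.sqrt_nonneg _)
    · simp
  have h2 := pow_le_pow_left₀ (by positivity) h1 2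
  rw [mul_pow, mul_pow, he, one_mul, div_pow, Real.sq_sqrt (by positivity)] at h2
  refine le_trans (le_of_eq ?_) h2
  field_simp

lemma sq_abs_add_sub_abs_sub_ge {u v μ : ℝ} (hu : μ ≤ u ^ 2) (hv : μ ≤ v ^ 2) :
    4 * μ ≤ (|u + v| - |u - v|) ^ 2 := by
  have h1 : (|u + v| - |u - v|) ^ 2 = 2 * u ^ 2 + 2 * v ^ 2 - 2 * |u ^ 2 - v ^ 2| := by
    rw [sub_sq, sq_abs, sq_abs, mul_assoc, ← abs_mul,
      show (u + v) * (u - v) = u ^ 2 - v ^ 2 by ring]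
    ring
  rw [h1]
  rcases abs_cases (u ^ 2 - v ^ 2) with ⟨h, _⟩ | ⟨h, _⟩ <;> linarith

lemma hasChernoffBound_mergeFails {f : Fin n ↪ Fin N} {x : Fin N → ℝ} {T M : ℕ}
    {σ : Fin n → ℝ} {τ : ℝ} (hxs : ∑ i, x i ^ 2 = 1)
    (hσ : ∀ a, σ a ^ 2 = 1) (h : Coherent f x (T * 2) σ) (hτ : 0 < τ)
    (hx : ∀ a, τ ≤ |x (f a)|) {p : Fin n} (hp1 : T ≤ p.1) (hp2 : p.1 < T * 2) :
    HasChernoffBound (born (mergeBasis f T σ) (realState x)) (M * T) (MergeFails f x T σ p)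
      (Real.exp (-(M * (n + 1) * τ ^ 2 / 4))) := by
  have hT : 0 < T := by omega
  have hr : p.1 % T = p.1 - T := by
    rw [Nat.mod_eq_sub_mod hp1, Nat.mod_eq_of_lt (by omega)]
  have hpn := p.2
  obtain ⟨u, hu⟩ : ∃ u, u = classAmp f σ x (T * 2) (p.1 % T) := ⟨_, rfl⟩
  obtain ⟨v, hv⟩ : ∃ v, v = classAmp f σ x (T * 2) (p.1 % T + T) := ⟨_, rfl⟩
  have hb := (exists_mergeBasis f T σ).choose_spec hσ
  have hb1 : born (mergeBasis f T σ) (realState x) (f p) = |u - v| ^ 2 := by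
    rw [sq_abs, mergeBasis, hb p hp2 (by omega) x, ← hu, ← hv, if_pos hp1]
    ring
  have hq : (posMod T p).1 = p.1 % T := rfl
  have hb2 : born (mergeBasis f T σ) (realState x) (f (posMod T p)) = |u + v| ^ 2 := by
    rw [sq_abs, mergeBasis, hb _ (by omega) (by rw [hq, Nat.mod_mod]; omega) x, hq, Nat.mod_mod,
      ← hu, ← hv, if_neg (by omega)]
    ring
  have hne : f (posMod T p) ≠ f p := fun he => by
    have := congrArg Fin.val (f.injective he)
    omega
  obtain ⟨μ, hμ⟩ : ∃ μ : ℝ, μ = (n + 1) * τ ^ 2 / (8 * T) := ⟨_, rfl⟩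
  have hT' : (0 : ℝ) < T := by exact_mod_cast hT
  have hμ0 : 0 < μ := by rw [hμ]; positivity
  have hmass : ∀ s, s < T * 2 → s < n → μ ≤ classAmp f σ x (T * 2) s ^ 2 := by
    intro s hs hsn
    refine le_trans ?_ (le_classAmp_sq hσ h hτ.le hx hs hsn)
    have hc : ((n : ℝ) + 1) ≤ 2 * (T * 2) * classCard n (T * 2) s := by
      exact_mod_cast le_classCard hs hsn
    rw [hμ, div_le_div_iff₀ (by positivity) two_pos]
    have := mul_le_mul_of_nonneg_right hc (sq_nonneg τ)
    linarith
  have hu2 : μ ≤ u ^ 2 := hu ▸ hmass _ (by omega) (by omega)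
  have hv2 : μ ≤ v ^ 2 := hv ▸ hmass _ (by omega) (by omega)
  have hsep := sq_abs_add_sub_abs_sub_ge hu2 hv2
  have hbound : ∀ d : ℝ, 4 * μ ≤ d ^ 2 →
      Real.exp (-((M * T : ℕ) * (d ^ 2 / 2))) ≤ Real.exp (-(M * (n + 1) * τ ^ 2 / 4)) := by
    intro d hd
    refine Real.exp_le_exp.2 (neg_le_neg ?_)
    calc (M : ℝ) * (n + 1) * τ ^ 2 / 4 = (M * T : ℕ) * (4 * μ / 2) := by
          rw [hμ]; push_cast; field_simp; ring
      _ ≤ _ := by gcongr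
  have hweak : ∀ {E : (Fin N → ℕ) → Prop} {d : ℝ}, 4 * μ ≤ d ^ 2 →
      HasChernoffBound (born (mergeBasis f T σ) (realState x)) (M * T) E
        (Real.exp (-((M * T : ℕ) * (d ^ 2 / 2)))) →
      HasChernoffBound (born (mergeBasis f T σ) (realState x)) (M * T) E
        (Real.exp (-(M * (n + 1) * τ ^ 2 / 4))) :=
    fun hd ⟨κ, g, h1, h2, h3, h4⟩ => ⟨κ, g, h1, h2, h3, h4.trans (hbound _ hd)⟩
  have hsum := sum_born (b := mergeBasis f T σ) (norm_realState hxs)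
  unfold MergeFails
  rw [← hu, ← hv]
  split_ifs with huv
  · refine hweak hsep (hasChernoffBound_compare born_nonneg hsum hne _ (abs_nonneg _) ?_ hb2 hb1)
    rw [← sq_lt_sq]
    nlinarith
  · have hsep' : 4 * μ ≤ (|u - v| - |u + v|) ^ 2 := by rw [sub_sq_comm]; exact hsep
    refine hweak hsep' (hasChernoffBound_compare born_nonneg hsum hne.symm _ (abs_nonneg _) ?_
      hb1 hb2)
    rw [← sq_lt_sq]
    have h0 : u * v ≠ 0 := fun h0 => by nlinarith [mul_le_mul hu2 hv2 hμ0.le (sq_nonneg u)]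
    have := lt_of_le_of_ne (not_lt.1 huv) h0
    nlinarith

lemma coherent_mergeSigns {f : Fin n ↪ Fin N} {x : Fin N → ℝ} {T : ℕ} (hT : 0 < T)
    {σ : Fin n → ℝ} {c : Fin N → ℕ} (h : Coherent f x (T * 2) σ)
    (hc : ∀ p : Fin n, T ≤ p.1 → p.1 < T * 2 → ¬ MergeFails f x T σ p c) :
    Coherent f x T (mergeSigns f T σ c) := by
  -- By symmetry in `a` and `b`, this is the only case in which they lie in different halves.
  have hmix : ∀ a b : Fin n, a.1 % (T * 2) = a.1 % T → b.1 % (T * 2) = a.1 % T + T →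
      0 < mergeSigns f T σ c a * x (f a) * (mergeSigns f T σ c b * x (f b)) := by
    intro a b ha hb
    have hr := Nat.mod_lt a.1 hT
    have hbm : b.1 % T = a.1 % T := (mod_eq_iff_mod_mul_two hr b.1).2 (Or.inr hb)
    have hp : (posMod (T * 2) b).1 = a.1 % T + T := hb
    have hpT : (posMod (T * 2) b).1 % T = a.1 % T := by
      rw [hp, Nat.add_mod_right, Nat.mod_mod]
    have hlow : posMod T (posMod (T * 2) b) = posMod T b := Fin.ext (hpT.trans hbm.symm)
    have hgood := hc (posMod (T * 2) b) (by omega) (by omega)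
    rw [MergeFails, hpT, hlow] at hgood
    have hA := classAmp_mul_pos h a
    have hB := classAmp_mul_pos h b
    rw [ha] at hA
    rw [hb] at hB
    have hAB := mul_pos hA hB
    rw [mul_mul_mul_comm] at hAB
    have ea : mergeSigns f T σ c a = σ a := if_neg (by omega)
    rw [ea]
    split_ifs at hgood with h0
    · have eb : mergeSigns f T σ c b = σ b := if_neg (by omega)
      rw [eb]
      exact pos_of_mul_pos_right hAB h0.le
    · have eb : mergeSigns f T σ c b = -σ b := if_pos ⟨by omega, by omega⟩
      rw [eb]
      have := neg_of_mul_pos_right hAB (not_lt.1 h0)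
      linarith
  intro a b hab
  have ha := (mod_eq_iff_mod_mul_two (Nat.mod_lt a.1 hT) a.1).1 rfl
  have hb := (mod_eq_iff_mod_mul_two (Nat.mod_lt a.1 hT) b.1).1 hab.symm
  by_cases hsame : a.1 % (T * 2) = b.1 % (T * 2)
  · have h1 := h a b hsame
    have e1 : posMod T a = posMod T b := Fin.ext hab
    have e2 : posMod (T * 2) a = posMod (T * 2) b := Fin.ext hsame
    unfold mergeSigns
    rw [e1, e2, hsame]
    split_ifs
    · linarith
    · exact h1
  · rcases ha with ha | ha
    · exact hmix a b ha (by omega)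
    · rw [mul_comm]
      exact hmix b a (by omega) (by omega)

end TomographyAlgorithm

/-! ### The sign-finding phase -/

namespace TomographyAlgorithm

variable {N n : ℕ}

/-- Starting from signs that are coherent on residue classes modulo `2 ^ k`, merge the classes
down to a single one and output the vector `out σ` for the resulting signs `σ`. The merge into
classes modulo `2 ^ k` uses `M * 2 ^ k` copies: the larger the classes, the fewer. -/
noncomputable def signPhase (f : Fin n ↪ Fin N) (M : ℕ) (out : (Fin n → ℝ) → Fin N → ℝ) :
    ℕ → (Fin n → ℝ) → TomographyAlgorithm N
  | 0, σ => output (out σ)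
  | k + 1, σ => measureMany (mergeBasis f (2 ^ k) σ) (M * 2 ^ k) fun c =>
      signPhase f M out k (mergeSigns f (2 ^ k) σ c)

lemma time_signPhase_le (f : Fin n ↪ Fin N) (M : ℕ) (out : (Fin n → ℝ) → Fin N → ℝ) (k : ℕ)
    (σ : Fin n → ℝ) : (signPhase f M out k σ).time ≤ M * 2 ^ k := by
  induction k generalizing σ with
  | zero => simp [signPhase, time]
  | succ k ih =>
    unfold signPhase
    refine (time_measureMany_le fun c _ => ih _).trans (le_of_eq ?_)
    ring

lemma exists_of_mem_outputs_signPhase {f : Fin n ↪ Fin N} {M : ℕ}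
    {out : (Fin n → ℝ) → Fin N → ℝ} {k : ℕ} {σ : Fin n → ℝ} {y : Fin N → ℝ}
    (hy : y ∈ (signPhase f M out k σ).outputs) : ∃ σ', y = out σ' := by
  induction k generalizing σ with
  | zero => exact ⟨σ, hy⟩
  | succ k ih =>
    obtain ⟨c, _, h⟩ := exists_of_mem_outputs_measureMany hy
    exact ih h

lemma card_upper_positions_le (T : ℕ) :
    (Finset.univ.filter fun p : Fin n => T ≤ p.1 ∧ p.1 < T * 2).card ≤ T := by
  calc _ ≤ (Finset.Ico T (T * 2)).card :=
        Finset.card_le_card_of_injOn Fin.val (fun p hp => by simpa using hp)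
          Fin.val_injective.injOn
    _ = T := by rw [Nat.card_Ico]; omega

/-- There are fewer than `2 ^ k` merges below level `k`, and each fails with the same
probability, because the sample sizes `M * 2 ^ j` offset the shrinking mass of the classes. -/
lemma le_prob_signPhase {f : Fin n ↪ Fin N} {M : ℕ} {out : (Fin n → ℝ) → Fin N → ℝ}
    {x : Fin N → ℝ} {τ : ℝ} {G : Set (Fin N → ℝ)} (hxs : ∑ i, x i ^ 2 = 1) (hτ : 0 < τ)
    (hx : ∀ a, τ ≤ |x (f a)|)
    (hout : ∀ σ, (∀ a, σ a ^ 2 = 1) → Coherent f x 1 σ → out σ ∈ G) (k : ℕ) {σ : Fin n → ℝ}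
    (hσ : ∀ a, σ a ^ 2 = 1) (h : Coherent f x (2 ^ k) σ) :
    1 - 2 ^ k * Real.exp (-(M * (n + 1) * τ ^ 2 / 4)) ≤
      (signPhase f M out k σ).prob (realState x) G := by
  induction k generalizing σ with
  | zero =>
    have : (signPhase f M out 0 σ).prob (realState x) G = 1 := if_pos (hout σ hσ h)
    rw [this]
    have := Real.exp_pos (-(M * (n + 1) * τ ^ 2 / 4))
    linarith
  | succ k ih =>
    obtain ⟨β, hβ⟩ : ∃ β, β = Real.exp (-(M * (n + 1) * τ ^ 2 / 4)) := ⟨_, rfl⟩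
    have hβ0 : 0 < β := hβ ▸ Real.exp_pos _
    rw [← hβ] at ih ⊢
    let I := Finset.univ.filter fun p : Fin n => 2 ^ k ≤ p.1 ∧ p.1 < 2 ^ k * 2
    have hI : ∀ p, p ∈ I ↔ 2 ^ k ≤ p.1 ∧ p.1 < 2 ^ k * 2 := by simp [I]
    rw [pow_succ] at h
    have key := sub_sum_le_prob_measureMany (b := mergeBasis f (2 ^ k) σ) (norm_realState hxs) I
      (m := M * 2 ^ k) (E := MergeFails f x (2 ^ k) σ) (β := fun _ => β)
      (a := 1 - 2 ^ k * β) (G := G) (k := fun c => signPhase f M out k (mergeSigns f (2 ^ k) σ c))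
      (by have : 0 ≤ 2 ^ k * β := by positivity
          linarith)
      (fun p hp => hβ ▸ hasChernoffBound_mergeFails hxs hσ h hτ hx ((hI p).1 hp).1
        ((hI p).1 hp).2)
      (fun c hc => ih (mergeSigns_sq hσ) (coherent_mergeSigns (by positivity) h
        fun p h1 h2 => hc p ((hI p).2 ⟨h1, h2⟩)))
    refine le_trans ?_ key
    have hcard : (I.card : ℝ) ≤ 2 ^ k := by exact_mod_cast card_upper_positions_le (2 ^ k)
    have := mul_le_mul_of_nonneg_right hcard hβ0.le
    rw [Finset.sum_const, nsmul_eq_mul, pow_succ]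
    linarith

/-! ### The complete algorithm -/

/-- The estimate of the amplitude moduli from the outcome counts of `m` measurements in the
computational basis. -/
noncomputable def amplitude (m : ℕ) (c : Fin N → ℕ) (i : Fin N) : ℝ := √(c i / m)

/-- The coordinates with estimated modulus at least `ε / 2`. -/
noncomputable def heavy (ε : ℝ) (m : ℕ) (c : Fin N → ℕ) : Finset (Fin N) :=
  Finset.univ.filter fun i => ε / 2 ≤ amplitude m c i

/-- The increasing enumeration of the heavy coordinates. -/
noncomputable def heavyEmb (ε : ℝ) (m : ℕ) (c : Fin N → ℕ) :
    Fin (heavy ε m c).card ↪ Fin N :=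
  ((heavy ε m c).orderEmbOfFin rfl).toEmbedding

/-- The vector supported on the range of `f` with moduli `e` and signs `σ`. -/
noncomputable def signedVector (f : Fin n ↪ Fin N) (e : Fin N → ℝ) (σ : Fin n → ℝ) : Fin N → ℝ :=
  Function.extend f (fun a => σ a * e (f a)) 0

/-- Estimate the moduli from `m` measurements in the computational basis, then find the signs of
the heavy coordinates. The number of copies per merge is `L` divided by their number. Signs that
are all `1` are coherent modulo a number exceeding all positions, where merging starts. -/
noncomputable def tomography (N : ℕ) (ε : ℝ) (m : ℕ) (L : ℝ) : TomographyAlgorithm N :=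
  measureMany (EuclideanSpace.basisFun (Fin N) ℂ) m fun c =>
    signPhase (heavyEmb ε m c) ⌈L / ((heavy ε m c).card + 1)⌉₊
      (signedVector (heavyEmb ε m c) (amplitude m c)) (Nat.log 2 (heavy ε m c).card + 1) 1

lemma range_heavyEmb (ε : ℝ) (m : ℕ) (c : Fin N → ℕ) :
    Set.range (heavyEmb ε m c) = heavy ε m c :=
  Finset.range_orderEmbOfFin _ rfl

lemma card_heavy_le {ε : ℝ} (hε : 0 < ε) {m : ℕ} (hm : 0 < m) {c : Fin N → ℕ}
    (hc : ∑ i, c i = m) : ((heavy ε m c).card : ℝ) ≤ 4 / ε ^ 2 := by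
  have hm' : (0 : ℝ) < m := by exact_mod_cast hm
  have h1 : ((heavy ε m c).card : ℝ) * (ε / 2) ^ 2 ≤ 1 := by
    calc _ = ∑ i ∈ heavy ε m c, (ε / 2) ^ 2 := by rw [Finset.sum_const, nsmul_eq_mul]
      _ ≤ ∑ i ∈ heavy ε m c, (c i : ℝ) / m := Finset.sum_le_sum fun i hi => by
          rw [heavy, Finset.mem_filter, amplitude, Real.le_sqrt (by positivity) (by positivity)]
            at hi
          exact hi.2
      _ ≤ ∑ i, (c i : ℝ) / m :=
          Finset.sum_le_sum_of_subset_of_nonneg (Finset.subset_univ _) fun i _ _ => by positivity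
      _ = 1 := by
          rw [← Finset.sum_div, div_eq_one_iff_eq hm'.ne']
          exact_mod_cast hc
  rw [le_div_iff₀ (by positivity)]
  linarith

lemma two_pow_log_le (n : ℕ) : (2 : ℝ) ^ (Nat.log 2 n + 1) ≤ 2 * (n + 1) := by
  have h : 2 ^ Nat.log 2 n ≤ n + 1 := by
    rcases Nat.eq_zero_or_pos n with rfl | hn
    · simp
    · exact (Nat.pow_log_le_self 2 hn.ne').trans (Nat.le_succ n)
  have h' : (2 : ℝ) ^ Nat.log 2 n ≤ n + 1 := by exact_mod_cast h
  rw [pow_succ]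
  linarith

lemma time_tomography_le {ε : ℝ} (hε : 0 < ε) {m : ℕ} (hm : 0 < m) {L : ℝ} (hL : 0 ≤ L) :
    ((tomography N ε m L).time : ℝ) ≤ m + 2 * (L + 4 / ε ^ 2 + 1) := by
  have key : (tomography N ε m L).time ≤ m + ⌊2 * (L + 4 / ε ^ 2 + 1)⌋₊ := by
    refine time_measureMany_le fun c hc => (time_signPhase_le _ _ _ _ _).trans (Nat.le_floor ?_)
    have hn := card_heavy_le hε hm hc
    generalize (heavy ε m c).card = n at *
    have h2 := two_pow_log_le n
    have h3 := (Nat.ceil_lt_add_one (show 0 ≤ L / ((n : ℝ) + 1) by positivity)).le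
    push_cast
    calc _ ≤ (L / ((n : ℝ) + 1) + 1) * (2 * (n + 1)) := by gcongr
      _ = 2 * (L + n + 1) := by field_simp; ring
      _ ≤ _ := by linarith
  calc ((tomography N ε m L).time : ℝ) ≤ m + (⌊2 * (L + 4 / ε ^ 2 + 1)⌋₊ : ℕ) := by
        exact_mod_cast key
    _ ≤ _ := by gcongr; exact Nat.floor_le (by positivity)

lemma ncard_support_le_of_mem_outputs {ε : ℝ} (hε : 0 < ε) {m : ℕ} (hm : 0 < m) {L : ℝ}
    {y : Fin N → ℝ} (hy : y ∈ (tomography N ε m L).outputs) :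
    ({i : Fin N | y i ≠ 0}.ncard : ℝ) ≤ 4 / ε ^ 2 := by
  obtain ⟨c, hc, h⟩ := exists_of_mem_outputs_measureMany hy
  obtain ⟨σ, rfl⟩ := exists_of_mem_outputs_signPhase h
  refine le_trans ?_ (card_heavy_le hε hm hc)
  refine Nat.cast_le.2 (le_of_le_of_eq ?_ (Set.ncard_coe_finset (heavy ε m c)))
  refine (Set.ncard_le_ncard (fun i hi => ?_) (Set.toFinite _))
  by_contra hi'
  refine hi (Function.extend_apply' _ _ _ fun hex => hi' ?_)
  rw [← range_heavyEmb]
  exact hex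

/-- Signs that are coherent on all heavy coordinates reproduce `x` up to its global sign. -/
lemma signedVector_mem_approximations {x : Fin N → ℝ} {ε : ℝ} (hε : 0 < ε)
    {f : Fin n ↪ Fin N} {e : Fin N → ℝ} {σ : Fin n → ℝ} (he : ∀ i, |e i - (|x i|)| < ε)
    (hlight : ∀ i, i ∉ Set.range f → |x i| < ε) (hσ : ∀ a, σ a ^ 2 = 1)
    (h : Coherent f x 1 σ) : signedVector f e σ ∈ approximations x ε := by
  have key : ∀ s : ℝ, s ^ 2 = 1 → (∀ a, 0 < s * (σ a * x (f a))) →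
      ‖(fun i => s * x i) - signedVector f e σ‖ < ε := by
    intro s hs hpos
    refine (pi_norm_lt_iff hε).2 fun i => ?_
    rw [Real.norm_eq_abs, Pi.sub_apply]
    have hs1 : |s| = 1 := by
      rw [← sq_eq_sq₀ (abs_nonneg _) zero_le_one, sq_abs, hs, one_pow]
    by_cases hi : i ∈ Set.range f
    · obtain ⟨a, rfl⟩ := hi
      have hσ1 : |σ a| = 1 := by
        rw [← sq_eq_sq₀ (abs_nonneg _) zero_le_one, sq_abs, hσ, one_pow]
      have hx : |x (f a)| = s * (σ a * x (f a)) := by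
        rw [← abs_of_pos (hpos a), abs_mul, abs_mul, hs1, hσ1, one_mul, one_mul]
      have hv : signedVector f e σ (f a) = σ a * e (f a) := f.injective.extend_apply _ _ a
      have e1 : s * x (f a) - σ a * e (f a) = -(σ a * (e (f a) - |x (f a)|)) := by
        rw [hx]
        linear_combination (-(s * x (f a))) * hσ a
      rw [hv, e1, abs_neg, abs_mul, hσ1, one_mul]
      exact he _
    · have hv : signedVector f e σ i = 0 := Function.extend_apply' _ _ _ hi
      rw [hv, sub_zero, abs_mul, hs1, one_mul]
      exact hlight i hi
  by_cases hall : ∀ a, 0 < 1 * (σ a * x (f a))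
  · left
    have := key 1 (by norm_num) hall
    simpa only [one_mul] using this
  · right
    push Not at hall
    obtain ⟨a, ha⟩ := hall
    have := key (-1) (by norm_num) fun b => by
      have := h a b (by rw [Nat.mod_one, Nat.mod_one])
      nlinarith
    simp only [neg_one_mul] at this
    exact this

lemma le_prob_tomography {x : Fin N → ℝ} (hxs : ∑ i, x i ^ 2 = 1) {ε : ℝ} (hε : 0 < ε) {m : ℕ}
    (hm : 0 < m) {L : ℝ} :
    1 - 2 * (N + 1) * Real.exp (-(L * ε ^ 2 / 64)) - 2 * N * Real.exp (-(m * ε ^ 2 / 64)) ≤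
      (tomography N ε m L).prob (realState x) (approximations x ε) := by
  obtain ⟨ψ, hψ⟩ : ∃ ψ, ψ = realState x := ⟨_, rfl⟩
  have hψ1 : ‖ψ‖ = 1 := hψ ▸ norm_realState hxs
  have hborn : ∀ i, born (EuclideanSpace.basisFun (Fin N) ℂ) ψ i = |x i| ^ 2 := fun i => by
    rw [born, EuclideanSpace.basisFun_inner, hψ]
    simp [realState]
  let E : Fin N × Bool → (Fin N → ℕ) → Prop := fun i c =>
    if i.2 then |x i.1| + ε / 4 ≤ √(c i.1 / m) else √(c i.1 / m) ≤ |x i.1| - ε / 4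
  have hE : ∀ i ∈ Finset.univ, HasChernoffBound (born (EuclideanSpace.basisFun (Fin N) ℂ) ψ) m
      (E i) (Real.exp (-(m * ε ^ 2 / 64))) := by
    have e1 : (m : ℝ) * ε ^ 2 / 64 = m * (ε / 4 / 2) ^ 2 := by ring
    rw [e1]
    rintro ⟨i, _ | _⟩ _
    · exact hasChernoffBound_lower born_nonneg (sum_born hψ1) i hm (hborn i) (by positivity)
    · exact hasChernoffBound_upper born_nonneg (sum_born hψ1) i hm (abs_nonneg _) (hborn i)
        (by positivity)
  have key := sub_sum_le_prob_measureMany hψ1 Finset.univ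
    (a := 1 - 2 * (N + 1) * Real.exp (-(L * ε ^ 2 / 64))) (G := approximations x ε)
    (k := fun c => signPhase (heavyEmb ε m c) ⌈L / ((heavy ε m c).card + 1)⌉₊
      (signedVector (heavyEmb ε m c) (amplitude m c)) (Nat.log 2 (heavy ε m c).card + 1) 1)
    (by have : 0 ≤ 2 * ((N : ℝ) + 1) * Real.exp (-(L * ε ^ 2 / 64)) := by positivity
        linarith) hE ?_
  · have hsum : ∑ _i : Fin N × Bool, Real.exp (-(m * ε ^ 2 / 64)) =
        2 * N * Real.exp (-(m * ε ^ 2 / 64)) := by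
      rw [Finset.sum_const, nsmul_eq_mul, Finset.card_univ, Fintype.card_prod, Fintype.card_bool,
        Fintype.card_fin]
      push_cast
      ring
    rw [hsum, hψ] at key
    exact key
  intro c hc
  have hest : ∀ i, |amplitude m c i - (|x i|)| < ε / 4 := fun i => by
    have h1 : ¬ |x i| + ε / 4 ≤ √(c i / m) := hc (i, true) (Finset.mem_univ _)
    have h2 : ¬ √(c i / m) ≤ |x i| - ε / 4 := hc (i, false) (Finset.mem_univ _)
    rw [abs_lt, amplitude]
    constructor <;> linarith
  have hmem : ∀ i, i ∈ Set.range (heavyEmb ε m c) ↔ ε / 2 ≤ amplitude m c i := fun i => by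
    rw [range_heavyEmb]
    simp [heavy]
  have hcardN : (heavy ε m c).card ≤ N := by
    simpa using Finset.card_le_univ (heavy ε m c)
  have hx : ∀ a, ε / 4 ≤ |x (heavyEmb ε m c a)| := fun a => by
    have h1 := (hmem _).1 ⟨a, rfl⟩
    have h2 := (abs_lt.1 (hest (heavyEmb ε m c a))).2
    linarith
  have hlight : ∀ i, i ∉ Set.range (heavyEmb ε m c) → |x i| < ε := fun i hi => by
    rw [hmem, not_le] at hi
    linarith [(abs_lt.1 (hest i)).1]
  have hstart : Coherent (heavyEmb ε m c) x (2 ^ (Nat.log 2 (heavy ε m c).card + 1)) 1 := by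
    intro a b hab
    have hlt := Nat.lt_pow_succ_log_self one_lt_two (heavy ε m c).card
    rw [Nat.mod_eq_of_lt (a.2.trans hlt), Nat.mod_eq_of_lt (b.2.trans hlt)] at hab
    rw [Fin.ext hab]
    have : x (heavyEmb ε m c b) ≠ 0 := fun h0 => by
      have := hx b
      rw [h0, abs_zero] at this
      linarith
    simp only [Pi.one_apply, one_mul]
    exact mul_self_pos.2 this
  have hsign := le_prob_signPhase (M := ⌈L / (((heavy ε m c).card : ℝ) + 1)⌉₊)
    (out := signedVector (heavyEmb ε m c) (amplitude m c)) (G := approximations x ε) hxs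
    (show 0 < ε / 4 by positivity) hx
    (fun σ hσ h => signedVector_mem_approximations hε
      (fun i => (hest i).trans (by linarith)) hlight hσ h) _ (by simp) hstart
  rw [hψ]
  refine le_trans (sub_le_sub_left ?_ 1) hsign
  generalize (heavy ε m c).card = n at hcardN ⊢
  refine mul_le_mul ((two_pow_log_le n).trans ?_) (Real.exp_le_exp.2 (neg_le_neg ?_))
    (Real.exp_pos _).le (by positivity)
  · have : (n : ℝ) ≤ N := by exact_mod_cast hcardN
    linarith
  · have h1 := Nat.le_ceil (L / ((n : ℝ) + 1))
    rw [div_le_iff₀ (by positivity)] at h1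
    have := mul_le_mul_of_nonneg_right h1 (sq_nonneg ε)
    linarith

end TomographyAlgorithm

open TomographyAlgorithm

theorem mainTheorem1 :
    ∃ C : ℝ, 0 < C ∧ ∀ (N : ℕ) (ε η : ℝ), 2 ≤ N → 0 < ε → 0 < η → η < 1 →
      ∃ A : TomographyAlgorithm N,
        (A.time : ℝ) ≤ C * (Real.log N + Real.log (1 / η)) / ε ^ 2 ∧
        (∀ y ∈ A.outputs, ({i : Fin N | y i ≠ 0}.ncard : ℝ) < 36 * Real.log N / ε ^ 2) ∧
        ∀ x : Fin N → ℝ, ∑ i, x i ^ 2 = 1 →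
          1 - η ≤ A.prob (realState x) (approximations x ε) := by
  refine ⟨800, by norm_num, fun N ε η hN hε hη hη1 => ?_⟩
  have hN' : (2 : ℝ) ≤ N := by exact_mod_cast hN
  have hlogN : 1 / 2 < Real.log N := by
    have := Real.log_le_log two_pos hN'
    linarith [Real.log_two_gt_d9]
  obtain ⟨ℓ, hℓ⟩ : ∃ ℓ, ℓ = Real.log N + Real.log (1 / η) := ⟨_, rfl⟩
  have hℓ' : 1 / 2 < ℓ := by
    have := Real.log_nonneg ((one_le_div hη).2 hη1.le)
    linarith
  rw [← hℓ]
  rcases lt_or_ge 1 ε with hε1 | hε1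
  · -- All amplitudes are at most `1 < ε`, so the zero vector is a good enough answer.
    refine ⟨output 0, ?_, ?_, fun x hx => ?_⟩
    · simp only [time, Nat.cast_zero]
      positivity
    · rintro y rfl
      simp only [Pi.zero_apply, ne_eq, not_true_eq_false, Set.ofPred_false, Set.ncard_empty,
        Nat.cast_zero]
      positivity
    · have hmem : (0 : Fin N → ℝ) ∈ approximations x ε := by
        left
        rw [sub_zero]
        refine (pi_norm_lt_iff hε).2 fun i => lt_of_le_of_lt ?_ hε1
        have := Finset.single_le_sum (fun j _ => sq_nonneg (x j)) (Finset.mem_univ i)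
        rw [hx] at this
        rw [Real.norm_eq_abs]
        exact (sq_le_one_iff_abs_le_one _).1 this
      have : (output 0 : TomographyAlgorithm N).prob (realState x) (approximations x ε) = 1 :=
        if_pos hmem
      linarith
  have hε2 : ε ^ 2 ≤ 1 := pow_le_one₀ hε.le hε1
  have hinv : 1 ≤ 1 / ε ^ 2 := (one_le_div (by positivity)).2 hε2
  obtain ⟨L, hL⟩ : ∃ L, L = 256 * ℓ / ε ^ 2 := ⟨_, rfl⟩
  have hL0 : 0 < L := by rw [hL]; positivity
  have hm : 0 < ⌈L⌉₊ := Nat.ceil_pos.2 hL0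
  refine ⟨tomography N ε ⌈L⌉₊ L, ?_, fun y hy => ?_, fun x hx => ?_⟩
  · have h1 := time_tomography_le (N := N) hε hm hL0.le
    have h2 := Nat.ceil_lt_add_one hL0.le
    have h3 : 1 / ε ^ 2 ≤ 2 * ℓ / ε ^ 2 := by gcongr; linarith
    have e1 : 800 * ℓ / ε ^ 2 = 3 * L + 16 * (2 * ℓ / ε ^ 2) := by rw [hL]; ring
    have e2 : 4 / ε ^ 2 = 4 * (1 / ε ^ 2) := by ring
    rw [e1]
    rw [e2] at h1
    linarith
  · refine (ncard_support_le_of_mem_outputs hε hm hy).trans_lt ?_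
    gcongr
    linarith
  · refine le_trans ?_ (le_prob_tomography hx hε hm)
    -- The exponent `256 / 64 = 4` leaves three spare factors `η / N ≤ 1 / 2` for the union bound.
    have hexp : Real.exp (-(L * ε ^ 2 / 64)) = (η / N) ^ 4 := by
      have e1 : -(L * ε ^ 2 / 64) = (4 : ℕ) * Real.log (η / N) := by
        rw [hL, div_mul_cancel₀ _ (by positivity), hℓ, Real.log_div hη.ne' (by positivity),
          one_div, Real.log_inv]
        push_cast
        ring
      rw [e1, Real.exp_nat_mul, Real.exp_log (by positivity)]
    have hexp' : Real.exp (-(⌈L⌉₊ * ε ^ 2 / 64)) ≤ (η / N) ^ 4 := by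
      rw [← hexp]
      gcongr
      exact Nat.le_ceil L
    rw [hexp]
    obtain ⟨z, hz⟩ : ∃ z, z = η / N := ⟨_, rfl⟩
    have hz0 : 0 < z := by rw [hz]; positivity
    have hz2 : z ≤ 1 / 2 := by
      rw [hz, div_le_div_iff₀ (by positivity) two_pos]
      linarith
    have hzN : N * z = η := by rw [hz]; field_simp
    rw [← hz] at hexp' ⊢
    have hz3 : z ^ 3 ≤ 1 / 8 := by
      calc z ^ 3 ≤ (1 / 2) ^ 3 := by gcongr
        _ = 1 / 8 := by norm_num
    have h1 : 2 * N * Real.exp (-(⌈L⌉₊ * ε ^ 2 / 64)) ≤ 2 * N * z ^ 4 := by gcongr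
    have h2 : 2 * ((N : ℝ) + 1) * z ^ 4 ≤ 4 * N * z ^ 4 :=
      mul_le_mul_of_nonneg_right (by linarith) (by positivity)
    have h3 : N * z ^ 4 ≤ η * (1 / 8) := by
      calc N * z ^ 4 = (N * z) * z ^ 3 := by ring
        _ = η * z ^ 3 := by rw [hzN]
        _ ≤ _ := by gcongr
    linarith
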